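/- Let $p\in[1,+\infty)$ and let $w=(w_n)_{n\in\mathbb Z}$ be a bounded sequence of positive real numbers. Let $B_w$ be the bilateral weighted shift on the (real or complex) Banach space $\ell^p(\mathbb Z)$, that is, the bounded operator determined by $B_w e_n=w_n e_{n-1}$ for $n\in\mathbb Z$, where $(e_n)_{n\in\mathbb Z}$ is the standard basis of $\ell^p(\mathbb Z)$. For a set $A$ of nonnegative integers put $$\underline d(A)=\liminf_{n\to\infty}\frac{\#\{a\in A: a\le n\}}{n},\qquad \overline d(A)=\limsup_{n\to\infty}\frac{\#\{a\in A: a\le n\}}{n}.$$ A bounded operator $T$ on a Banach space $X$ is called frequently hypercyclic (respectively $\mathcal U$-frequently hypercyclic) if there is a vector $x\in X$ such that for every nonempty open set $U\subset X$ the set $\{n\ge 0: T^n x\in U\}$ has positive lower density $\underline d$ (respectively positive upper density $\overline d$). Then the following assertions are equivalent: (i) $B_w$ is frequently hypercyclic on $\ell^p(\mathbb Z)$; (ii) $B_w$ is $\mathcal U$-frequently hypercyclic on $\ell^p(\mathbb Z)$; (iii) both series $\displaystyle\sum_{n\ge 1}\frac{1}{(w_1\cdots w_n)^p}$ and $\displaystyle\sum_{n<0}(w_{-1}\cdots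 w_n)^p$ converge. -/

import Mathlib

open Filter
open scoped ENNReal

noncomputable section

/-- The lower density `liminf #{a ∈ A : a ≤ n} / n` of a set `A` of nonnegative integers. -/
def lowerDensity (A : Set ℕ) : ℝ :=
  liminf (fun n : ℕ => ({a ∈ A | a ≤ n}.ncard : ℝ) / n) atTop

/-- The upper density `limsup #{a ∈ A : a ≤ n} / n` of a set `A` of nonnegative integers. -/
def upperDensity (A : Set ℕ) : ℝ :=
  limsup (fun n : ℕ => ({a ∈ A | a ≤ n}.ncard : ℝ) / n) atTop

/-- The quotients in the two densities lie in `[0, 2]`, so that the `liminf` and the `limsup`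
above are genuine. -/
theorem density_quotient_mem (A : Set ℕ) (n : ℕ) :
    0 ≤ ({a ∈ A | a ≤ n}.ncard : ℝ) / n ∧ ({a ∈ A | a ≤ n}.ncard : ℝ) / n ≤ 2 := by
  refine ⟨by positivity, ?_⟩
  rcases Nat.eq_zero_or_pos n with rfl | hn
  · simp
  have h1 : {a ∈ A | a ≤ n}.ncard ≤ n + 1 := by
    have h := Set.ncard_le_ncard (s := {a ∈ A | a ≤ n}) (t := (Finset.range (n + 1) : Set ℕ))
      (by
        intro a ha
        simpa using Nat.lt_succ_of_le ha.2) (Finset.finite_toSet _)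
    rwa [Set.ncard_coe_finset, Finset.card_range] at h
  have h2 : ({a ∈ A | a ≤ n}.ncard : ℝ) ≤ n + 1 := by exact_mod_cast h1
  have h3 : (1 : ℝ) ≤ n := by exact_mod_cast hn
  rw [div_le_iff₀ (by linarith)]
  linarith

section Dynamics

variable {𝕜 X : Type*} [RCLike 𝕜] [NormedAddCommGroup X] [NormedSpace 𝕜 X]

/-- `T` has a vector whose orbit visits every nonempty open set along a set of times of positive
lower density. -/
def IsFrequentlyHypercyclic (T : X →L[𝕜] X) : Prop :=
  ∃ x : X, ∀ U : Set X, IsOpen U → U.Nonempty → 0 < lowerDensity {n : ℕ | (T ^ n) x ∈ U}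

/-- `T` has a vector whose orbit visits every nonempty open set along a set of times of positive
upper density. -/
def IsUFrequentlyHypercyclic (T : X →L[𝕜] X) : Prop :=
  ∃ x : X, ∀ U : Set X, IsOpen U → U.Nonempty → 0 < upperDensity {n : ℕ | (T ^ n) x ∈ U}

end Dynamics

section Shift

variable (𝕜 : Type*) [RCLike 𝕜] (p : ℝ≥0∞)

theorem memℓp_shift (x : lp (fun _ : ℤ => 𝕜) p) :
    Memℓp (fun n : ℤ => x (n + 1)) p := by
  have hinj : Function.Injective (fun n : ℤ => n + 1) := add_left_injective 1
  rcases p.trichotomy with rfl | rfl | hp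
  · exact memℓp_zero ((lp.memℓp x).finite_dsupport.preimage hinj.injOn)
  · refine memℓp_infty ((lp.memℓp x).bddAbove.mono ?_)
    rintro _ ⟨n, rfl⟩
    exact ⟨n + 1, rfl⟩
  · exact memℓp_gen (((lp.memℓp x).summable hp).comp_injective hinj)

theorem norm_shift [Fact (1 ≤ p)] (x : lp (fun _ : ℤ => 𝕜) p) :
    ‖(⟨fun n : ℤ => x (n + 1), memℓp_shift 𝕜 p x⟩ : lp (fun _ : ℤ => 𝕜) p)‖ ≤ ‖x‖ := by
  have hp1 : 1 ≤ p := Fact.out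
  rcases p.trichotomy with rfl | rfl | hp
  · simp at hp1
  · exact lp.norm_le_of_forall_le (norm_nonneg x) fun n => lp.norm_apply_le_norm (by simp) x (n + 1)
  · refine lp.norm_le_of_tsum_le hp (norm_nonneg x) (le_of_eq ?_)
    rw [lp.norm_rpow_eq_tsum hp x]
    exact (Equiv.addRight (1 : ℤ)).tsum_eq (fun n => ‖x n‖ ^ p.toReal)

variable {p}

/-- For a bounded sequence `w` of positive reals, the bilateral weighted shift on `ℓ^p(ℤ)`: the
bounded operator `(x_n) ↦ (w_{n+1} x_{n+1})`, which sends `e_n` to `w_n e_{n-1}`. -/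
def bilateralShift [Fact (1 ≤ p)] (w : ℤ → ℝ) (hpos : ∀ n, 0 < w n)
    (hbdd : BddAbove (Set.range w)) : lp (fun _ : ℤ => 𝕜) p →L[𝕜] lp (fun _ : ℤ => 𝕜) p :=
  have key : ∃ C : ℝ, 0 ≤ C ∧ ∀ (x : lp (fun _ : ℤ => 𝕜) p) (n : ℤ),
      ‖(w (n + 1) : 𝕜) * x (n + 1)‖ ≤ ‖(C : 𝕜) * x (n + 1)‖ := by
    obtain ⟨C, hC⟩ := hbdd
    have hwC : ∀ n, w n ≤ C := fun n => hC ⟨n, rfl⟩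
    have hC0 : 0 ≤ C := (hpos 0).le.trans (hwC 0)
    refine ⟨C, hC0, fun x n => ?_⟩
    rw [norm_mul, norm_mul, RCLike.norm_ofReal, RCLike.norm_ofReal, abs_of_pos (hpos _),
      abs_of_nonneg hC0]
    gcongr
    exact hwC _
  have hmem : ∀ x : lp (fun _ : ℤ => 𝕜) p,
      Memℓp (fun n : ℤ => (w (n + 1) : 𝕜) * x (n + 1)) p := fun x => by
    obtain ⟨C, -, hC⟩ := key
    exact ((memℓp_shift 𝕜 p x).const_mul (C : 𝕜)).mono' (hC x)
  LinearMap.mkContinuousOfExistsBound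
    { toFun := fun x => ⟨fun n : ℤ => (w (n + 1) : 𝕜) * x (n + 1), hmem x⟩
      map_add' := fun x y => by
        ext n
        exact mul_add _ _ _
      map_smul' := fun c x => by
        ext n
        exact mul_left_comm _ _ _ }
    (by
      obtain ⟨C, hC0, hC⟩ := key
      refine ⟨C, fun x => ?_⟩
      have h0 : p ≠ 0 := (zero_lt_one.trans_le (Fact.out : 1 ≤ p)).ne'
      calc _ ≤ ‖(C : 𝕜) • (⟨fun n : ℤ => x (n + 1), memℓp_shift 𝕜 p x⟩ :
                lp (fun _ : ℤ => 𝕜) p)‖ := lp.norm_mono h0 (hC x)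
        _ ≤ C * ‖x‖ := by
            rw [norm_smul, RCLike.norm_ofReal, abs_of_nonneg hC0]
            gcongr
            exact norm_shift 𝕜 p x)

theorem bilateralShift_apply [Fact (1 ≤ p)] (w : ℤ → ℝ) (hpos : ∀ n, 0 < w n)
    (hbdd : BddAbove (Set.range w)) (x : lp (fun _ : ℤ => 𝕜) p) (n : ℤ) :
    bilateralShift 𝕜 w hpos hbdd x n = (w (n + 1) : 𝕜) * x (n + 1) := rfl

theorem bilateralShift_single [Fact (1 ≤ p)] (w : ℤ → ℝ) (hpos : ∀ n, 0 < w n)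
    (hbdd : BddAbove (Set.range w)) (n : ℤ) :
    bilateralShift 𝕜 w hpos hbdd (lp.single p n (1 : 𝕜)) =
      (w n : 𝕜) • lp.single p (n - 1) (1 : 𝕜) := by
  ext j
  rw [bilateralShift_apply, lp.coeFn_smul, Pi.smul_apply, smul_eq_mul]
  by_cases h : j = n - 1
  · subst h
    rw [sub_add_cancel, lp.single_apply_self, lp.single_apply_self]
  · rw [lp.single_apply_ne _ _ _ h, lp.single_apply_ne _ _ _ (fun h' => h (by omega))]
    simp

end Shift

end

/-!
Put `γ j = 1 / (w 1 ⋯ w j)` for `j ≥ 0` and `γ j = w (j + 1) ⋯ w 0` for `j ≤ 0` (`shiftScale`). Then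
`(B ^ n x) j / γ j = x (j + n) / γ (j + n)`, so that after division by `γ` the weighted shift becomes
the unweighted shift on the space `ℓ^p(ℤ, γ ^ p)`, and the two series converge together if and only
if `∑ γ j ^ p < ∞`, the sum being over all `j ∈ ℤ` (`summable_shiftScale_rpow_iff`).

Necessity. Let `x` be `𝒰`-frequently hypercyclic and let `A` be the set of `n` with
`‖B ^ n x - e₀‖ < 1 / 2`. For `n, m ∈ A` the coordinate `m - n` of `B ^ n x` has modulus at least
`γ (m - n) / 2`, hence `∑_{m ∈ A} γ (m - n) ^ p ≤ 3 ^ p` for every `n ∈ A`. Averaging over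
`n ∈ A ∩ [0, N]` bounds the sum of `γ ^ p` over the differences of `A` that occur with positive
frequency. As `A` has positive upper density, only finitely many of its translates can be almost
disjoint, and a maximal family of such translates shows that these differences form a syndetic set.
Since `γ j / γ (j + 1) = w (j + 1)` is bounded, `γ ^ p` is summable
(`summable_of_sum_translate_le`).

Sufficiency. If `∑ γ j ^ p < ∞`, there is even a weight `h`, increasing to infinity, with
`∑ γ j ^ p * h |j| < ∞` (`exists_monotone_tendsto_summable_mul`). The blocks `u / γ`, for `u` in a
dense sequence of finitely supported vectors, are copied around positions `n_k`, `k ∈ ℕ`; the block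
at `n_k` depends only on the level `v₂ k`, and `u` is assigned to a level so high that `u / γ` is
bounded by `h` in terms of the distance to the boundary of the block (`exists_glue`). Since
`v₂ (k !) ≤ k`, blocks of radius `v₂ k` can be placed disjointly with `n_k ≤ 3 * k`, so that each
level is used along a set of positive lower density (`lowerDensity_blockPosition_pos`). Seen from
`n_k`, all the other blocks contribute at most the tail of `∑ γ j ^ p * h |j|` beyond `v₂ k`.
-/

/-! ### Densities -/

theorem lowerDensity_le_upperDensity (A : Set ℕ) : lowerDensity A ≤ upperDensity A :=
  liminf_le_limsup
    (isBoundedUnder_of_eventually_le (a := 2) (.of_forall fun n => (density_quotient_mem A n).2))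
    (isBoundedUnder_of_eventually_ge (a := 0) (.of_forall fun n => (density_quotient_mem A n).1))

theorem frequently_lt_of_lt_upperDensity {A : Set ℕ} {δ : ℝ} (h : δ < upperDensity A) :
    ∃ᶠ N : ℕ in atTop, δ < ({a ∈ A | a ≤ N}.ncard : ℝ) / N :=
  frequently_lt_of_lt_limsup
    (isBoundedUnder_of_eventually_ge (a := 0)
      (.of_forall fun n => (density_quotient_mem A n).1)).isCoboundedUnder_le h

/-- A set that contains the values of an injective sequence of linear growth has positive lower
density. -/
theorem lowerDensity_pos_of_linear_growth {A : Set ℕ} {f : ℕ → ℕ} (hf : Function.Injective f)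
    {C : ℕ} (hC : 0 < C) (hfC : ∀ t, f t ≤ C * (t + 1)) (hfA : ∀ t, f t ∈ A) :
    0 < lowerDensity A := by
  have hC' : (0 : ℝ) < C := by exact_mod_cast hC
  have h1 : (1 / (2 * C) : ℝ) ≤ lowerDensity A := by
    refine le_liminf_of_le (isBoundedUnder_of_eventually_le (a := 2)
      (.of_forall fun n => (density_quotient_mem A n).2)).isCoboundedUnder_ge ?_
    filter_upwards [eventually_ge_atTop (2 * C)] with N hN
    have hN0 : (0 : ℝ) < N := by
      have : 0 < N := by omega
      exact_mod_cast this
    have hsub : ((Finset.range (N / C)).image f : Set ℕ) ⊆ {a ∈ A | a ≤ N} := by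
      intro a ha
      simp only [Finset.coe_image, Set.mem_image, Finset.coe_range, Set.mem_Iio] at ha
      obtain ⟨t, ht, rfl⟩ := ha
      exact ⟨hfA t, (hfC t).trans ((Nat.mul_le_mul_left C ht).trans (Nat.mul_div_le N C))⟩
    have hfin : {a ∈ A | a ≤ N}.Finite := (Set.finite_Iic N).subset fun a ha => ha.2
    have hcard := Set.ncard_le_ncard hsub hfin
    rw [Set.ncard_coe_finset, Finset.card_image_of_injective _ hf, Finset.card_range] at hcard
    have hdiv : (N : ℝ) < C * ((N / C : ℕ) + 1) := by
      have := Nat.lt_mul_div_succ N hC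
      exact_mod_cast this
    have hcard' : ((N / C : ℕ) : ℝ) ≤ ({a ∈ A | a ≤ N}.ncard : ℝ) := by exact_mod_cast hcard
    have hN' : (2 * C : ℝ) ≤ N := by exact_mod_cast hN
    rw [div_le_div_iff₀ (by positivity) hN0]
    nlinarith
  exact lt_of_lt_of_le (by positivity) h1

/-! ### Difference sets and summability -/

/-- The number of pairs of elements of `S` whose difference is `k`. -/
def diffCount (S : Finset ℤ) (k : ℤ) : ℕ := (S.filter fun n => n + k ∈ S).card

theorem diffCount_zero (S : Finset ℤ) : diffCount S 0 = S.card := by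
  unfold diffCount
  congr 1
  ext n
  simp

theorem card_translate_inter (S : Finset ℤ) (i j : ℤ) :
    ((S.map (addRightEmbedding i)) ∩ (S.map (addRightEmbedding j))).card =
      diffCount S (i - j) := by
  rw [diffCount,
    ← Finset.card_map (addRightEmbedding i) (s := S.filter fun n => n + (i - j) ∈ S)]
  congr 1
  ext x
  simp only [Finset.mem_inter, Finset.mem_map, Finset.mem_filter, addRightEmbedding_apply]
  constructor
  · rintro ⟨⟨n, hn, rfl⟩, m, hm, h⟩
    exact ⟨n, ⟨hn, by rwa [show n + (i - j) = m by omega]⟩, rfl⟩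
  · rintro ⟨n, ⟨hn, hm⟩, rfl⟩
    exact ⟨⟨n, hn, rfl⟩, n + (i - j), hm, by omega⟩

/-- A Bonferroni type inequality: sets of size at least `s` with pairwise intersections of size at
most `ε` have a large union. -/
theorem le_card_biUnion {ι α : Type*} [DecidableEq ι] [DecidableEq α] (F : Finset ι)
    (S : ι → Finset α) {s ε : ℝ} (hs : ∀ i ∈ F, s ≤ (S i).card)
    (hε : ∀ i ∈ F, ∀ j ∈ F, i ≠ j → ((S i ∩ S j).card : ℝ) ≤ ε) (h0 : 0 ≤ ε) :
    F.card * (s - F.card * ε) ≤ (F.biUnion S).card := by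
  induction F using Finset.induction_on with
  | empty => simp
  | insert a F ha ih =>
    have ih' := ih (fun i hi => hs i (Finset.mem_insert_of_mem hi)) fun i hi j hj =>
      hε i (Finset.mem_insert_of_mem hi) j (Finset.mem_insert_of_mem hj)
    have h1 := Finset.card_union_add_card_inter (S a) (F.biUnion S)
    have h2 : ((S a ∩ F.biUnion S).card : ℝ) ≤ F.card * ε := by
      have h3 : (S a ∩ F.biUnion S).card ≤ ∑ j ∈ F, (S a ∩ S j).card := by
        rw [Finset.inter_biUnion]
        exact Finset.card_biUnion_le
      calc ((S a ∩ F.biUnion S).card : ℝ) ≤ ∑ j ∈ F, ((S a ∩ S j).card : ℝ) := by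
            exact_mod_cast h3
        _ ≤ ∑ _j ∈ F, ε := Finset.sum_le_sum fun j hj =>
            hε a (Finset.mem_insert_self _ _) j (Finset.mem_insert_of_mem hj)
              fun h => ha (h ▸ hj)
        _ = F.card * ε := by simp
    have h4 := hs a (Finset.mem_insert_self _ _)
    have h5 : ((S a ∪ F.biUnion S).card : ℝ) + (S a ∩ F.biUnion S).card =
        (S a).card + (F.biUnion S).card := by exact_mod_cast h1
    rw [Finset.biUnion_insert, Finset.card_insert_of_notMem ha]
    push_cast
    have h6 : 0 ≤ F.card * ε := by positivity
    nlinarith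

/-- If the sums of `a` over `S - n` are bounded by `C` for all `n ∈ S`, then so is, up to the factor
`|S|`, the sum of `a` weighted by the number of representations as a difference. -/
theorem sum_mul_diffCount_le {S : Finset ℤ} {a : ℤ → ℝ} {C : ℝ} (ha : ∀ j, 0 ≤ a j)
    (hC : ∀ n ∈ S, ∑ m ∈ S, a (m - n) ≤ C) (K : Finset ℤ) :
    ∑ k ∈ K, a k * diffCount S k ≤ C * S.card := by
  have h1 : ∀ k, a k * diffCount S k = ∑ n ∈ S, if n + k ∈ S then a k else 0 := by
    intro k
    rw [← Finset.sum_filter, Finset.sum_const, nsmul_eq_mul, diffCount, mul_comm]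
  simp_rw [h1]
  rw [Finset.sum_comm]
  calc ∑ n ∈ S, ∑ k ∈ K, (if n + k ∈ S then a k else 0) ≤ ∑ n ∈ S, C := by
        refine Finset.sum_le_sum fun n hn => (le_trans ?_ (hC n hn))
        rw [← Finset.sum_filter]
        have h2 : ∑ m ∈ (K.filter fun k => n + k ∈ S).map (addLeftEmbedding n), a (m - n) =
            ∑ k ∈ K.filter (fun k => n + k ∈ S), a k := by
          rw [Finset.sum_map]
          exact Finset.sum_congr rfl fun k _ => by simp
        rw [← h2]
        refine Finset.sum_le_sum_of_subset_of_nonneg ?_ fun m _ _ => ha _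
        intro m hm
        simp only [Finset.mem_map, Finset.mem_filter, addLeftEmbedding_apply] at hm
        obtain ⟨k, hk, rfl⟩ := hm
        exact hk.2
    _ = C * S.card := by simp [mul_comm]

/-- The initial segment `A ∩ [0, N]`, as a finite set of integers. -/
noncomputable def initialSegment (A : Set ℕ) (N : ℕ) : Finset ℤ := by
  classical exact ((Finset.range (N + 1)).filter (· ∈ A)).map Nat.castEmbedding

theorem mem_initialSegment {A : Set ℕ} {N : ℕ} {z : ℤ} :
    z ∈ initialSegment A N ↔ ∃ n ∈ A, n ≤ N ∧ (n : ℤ) = z := by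
  classical
  simp only [initialSegment, Finset.mem_map, Finset.mem_filter, Finset.mem_range,
    Nat.castEmbedding_apply, Nat.lt_succ_iff]
  exact ⟨fun ⟨n, h, e⟩ => ⟨n, h.2, h.1, e⟩, fun ⟨n, h, h', e⟩ => ⟨n, ⟨h', h⟩, e⟩⟩

theorem card_initialSegment (A : Set ℕ) (N : ℕ) :
    (initialSegment A N).card = {a ∈ A | a ≤ N}.ncard := by
  classical
  rw [initialSegment, Finset.card_map, ← Set.ncard_coe_finset]
  congr 1
  ext a
  simp [and_comm]

theorem card_initialSegment_le (A : Set ℕ) (N : ℕ) : (initialSegment A N).card ≤ N + 1 := by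
  classical
  rw [initialSegment, Finset.card_map]
  exact (Finset.card_filter_le _ _).trans (by simp)

/-- The translates of `A ∩ [0, N]` by the elements of `F` are large, and almost disjoint up to the
density `c`. -/
def AlmostDisjointTranslates (A : Set ℕ) (δ c : ℝ) (F : Finset ℤ) (N : ℕ) : Prop :=
  δ * N < (initialSegment A N).card ∧
    ∀ i ∈ F, ∀ j ∈ F, i ≠ j → (diffCount (initialSegment A N) (i - j) : ℝ) < c * N

/-- The number of almost disjoint translates of a set of upper density greater than `δ` is bounded
in terms of `δ`. -/
theorem not_frequently_almostDisjointTranslates {A : Set ℕ} {δ c : ℝ} {m : ℕ} (hc : 0 ≤ c)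
    (hm : 3 ≤ m * (δ - m * c)) {F : Finset ℤ} (hF : F.card = m) :
    ¬ ∃ᶠ N in atTop, AlmostDisjointTranslates A δ c F N := by
  obtain ⟨b, hb⟩ : ∃ b : ℕ, ∀ i ∈ F, |i| ≤ b := by
    refine ⟨F.sup Int.natAbs, fun i hi => ?_⟩
    rw [Int.abs_eq_natAbs]
    exact_mod_cast Finset.le_sup (f := Int.natAbs) hi
  rw [not_frequently]
  filter_upwards [eventually_gt_atTop (2 * b + 1)] with N hN h
  set S := initialSegment A N with hS
  have h1 := le_card_biUnion F (fun i => S.map (addRightEmbedding i)) (s := δ * N) (ε := c * N)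
    (fun i _ => by rw [Finset.card_map]; exact h.1.le)
    (fun i hi j hj hij => by rw [card_translate_inter]; exact (h.2 i hi j hj hij).le)
    (by positivity)
  have h2 : (F.biUnion fun i => S.map (addRightEmbedding i)) ⊆
      Finset.Icc (-(b : ℤ)) (N + b) := by
    intro z hz
    simp only [Finset.mem_biUnion, Finset.mem_map, addRightEmbedding_apply, hS,
      mem_initialSegment] at hz
    obtain ⟨i, hi, _, ⟨n, -, hn, rfl⟩, rfl⟩ := hz
    have := abs_le.1 (hb i hi)
    rw [Finset.mem_Icc]
    omega
  have h3 := Finset.card_le_card h2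
  rw [Int.card_Icc] at h3
  have h4 : (F.biUnion fun i => S.map (addRightEmbedding i)).card ≤ 2 * N := by omega
  have h5 : ((F.biUnion fun i => S.map (addRightEmbedding i)).card : ℝ) ≤ 2 * N := by
    exact_mod_cast h4
  rw [hF] at h1
  have hN0 : (0 : ℝ) < N := by
    have : 0 < N := by omega
    exact_mod_cast this
  nlinarith

theorem le_pow_mul_shift {a : ℤ → ℝ} {M : ℝ} (hM : 1 ≤ M) (haM : ∀ j, a j ≤ M * a (j + 1))
    (j : ℤ) (k : ℕ) : a j ≤ M ^ k * a (j + k) := by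
  induction k with
  | zero => simp
  | succ k ih =>
    have h := haM (j + k)
    calc a j ≤ M ^ k * a (j + k) := ih
      _ ≤ M ^ k * (M * a (j + k + 1)) := by gcongr
      _ = M ^ (k + 1) * a (j + (k + 1 : ℕ)) := by
        rw [pow_succ, mul_assoc]; push_cast; rw [add_assoc]

/-- If `A` has positive upper density and the sums of `a ≥ 0` over the translates `A - n`, `n ∈ A`,
are bounded, then `a` is summable, as soon as `a j / a (j + 1)` is bounded. A maximal family of
almost disjoint translates of `A` shows that the differences which occur with positive frequency
form a syndetic set, and averaging over `n` bounds the sum of `a` over them. -/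
theorem summable_of_sum_translate_le {A : Set ℕ} (hA : 0 < upperDensity A) {a : ℤ → ℝ} {M C : ℝ}
    (ha : ∀ j, 0 ≤ a j) (hM : 1 ≤ M) (haM : ∀ j, a j ≤ M * a (j + 1))
    (hC : ∀ n ∈ A, ∀ N, ∑ m ∈ initialSegment A N, a (m - n) ≤ C) : Summable a := by
  classical
  obtain ⟨δ, hδ0, hδ⟩ := exists_between hA
  obtain ⟨m, hm⟩ := exists_nat_gt (4 / δ)
  have hm0 : (0 : ℝ) < m := lt_trans (by positivity) hm
  rw [div_lt_iff₀ hδ0] at hm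
  -- `c ≤ δ` makes `0` a frequent difference, and `m * (δ - m * c) ≥ 4 - 1`.
  set c : ℝ := min δ (1 / m ^ 2) with hc
  have hc0 : 0 < c := lt_min hδ0 (by positivity)
  have hcm : 3 ≤ m * (δ - m * c) := by
    have : m ^ 2 * c ≤ 1 := by
      calc m ^ 2 * c ≤ m ^ 2 * (1 / m ^ 2) := by gcongr; exact min_le_right _ _
        _ = 1 := by field_simp
    nlinarith
  let P := AlmostDisjointTranslates A δ c
  obtain ⟨F, hF, hmax⟩ : ∃ F : Finset ℤ, (∃ᶠ N in atTop, P F N) ∧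
      ∀ t ∉ F, ¬ ∃ᶠ N in atTop, P (insert t F) N := by
    by_contra! hcon
    have key : ∀ k : ℕ, ∃ F : Finset ℤ, F.card = k ∧ ∃ᶠ N in atTop, P F N := by
      intro k
      induction k with
      | zero =>
        refine ⟨∅, rfl, ?_⟩
        refine ((frequently_lt_of_lt_upperDensity hδ).and_eventually
          (eventually_gt_atTop 0)).mono fun N hN => ⟨?_, by simp⟩
        have : (0 : ℝ) < N := by exact_mod_cast hN.2
        rw [card_initialSegment]
        exact (lt_div_iff₀ this).1 hN.1
      | succ k ih =>
        obtain ⟨F, hF, hP⟩ := ih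
        obtain ⟨t, ht, hP'⟩ := hcon F hP
        exact ⟨insert t F, by rw [Finset.card_insert_of_notMem ht, hF], hP'⟩
    obtain ⟨F, hFm, hFP⟩ := key m
    exact not_frequently_almostDisjointTranslates hc0.le hcm hFm hFP
  have hsymm : ∀ (S : Finset ℤ) (i j : ℤ), diffCount S (i - j) = diffCount S (j - i) := by
    intro S i j
    rw [← card_translate_inter, ← card_translate_inter, Finset.inter_comm]
  have hev : ∀ t : ℤ, ∀ᶠ N in atTop, P F N →
      ∃ i ∈ F, c * N ≤ diffCount (initialSegment A N) (t - i) := by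
    intro t
    by_cases ht : t ∈ F
    · refine .of_forall fun N hN => ⟨t, ht, ?_⟩
      rw [sub_self, diffCount_zero]
      have : c * N ≤ δ * N := by gcongr; exact min_le_left _ _
      exact this.trans hN.1.le
    · filter_upwards [not_frequently.1 (hmax t ht)] with N hN hPF
      by_contra! hcon
      refine hN ⟨hPF.1, fun i hi j hj hij => ?_⟩
      rcases Finset.mem_insert.1 hi with rfl | hi' <;>
        rcases Finset.mem_insert.1 hj with rfl | hj'
      · exact absurd rfl hij
      · exact hcon j hj'
      · rw [hsymm]; exact hcon i hi'
      · exact hPF.2 i hi' j hj' hij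
  obtain ⟨b, hb⟩ : ∃ b : ℕ, ∀ i ∈ F, |i| ≤ b := by
    refine ⟨F.sup Int.natAbs, fun i hi => ?_⟩
    rw [Int.abs_eq_natAbs]
    exact_mod_cast Finset.le_sup (f := Int.natAbs) hi
  have hshift : Summable fun t : ℤ => a (t - b) := by
    refine summable_of_sum_le (c := M ^ (2 * b) * (F.card * (C * 2)) / c) (fun t => ha _)
      fun T => ?_
    obtain ⟨N, hPN, hT, hN1⟩ := (hF.and_eventually (((Finset.eventually_all T).2
      fun t _ => hev t).and (eventually_ge_atTop 1))).exists
    have hN1' : (1 : ℝ) ≤ N := by exact_mod_cast hN1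
    set S := initialSegment A N with hS
    have hSC : ∀ n ∈ S, ∑ m ∈ S, a (m - n) ≤ C := by
      intro n hn
      obtain ⟨n, hnA, -, rfl⟩ := mem_initialSegment.1 hn
      exact hC n hnA N
    have hC0 : 0 ≤ C := by
      have hne : S.Nonempty := by
        rw [← Finset.card_pos]
        have : (0 : ℝ) < S.card := lt_of_le_of_lt (by positivity) hPN.1
        exact_mod_cast this
      obtain ⟨n, hn⟩ := hne
      exact (Finset.sum_nonneg fun _ _ => ha _).trans (hSC n hn)
    have hcard : (S.card : ℝ) ≤ 2 * N := by
      have : (S.card : ℝ) ≤ N + 1 := by exact_mod_cast card_initialSegment_le A N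
      linarith
    have hpt : ∀ t ∈ T, a (t - b) * (c * N) ≤
        ∑ i ∈ F, M ^ (2 * b) * (a (t - i) * diffCount S (t - i)) := by
      intro t ht
      obtain ⟨i, hi, hti⟩ := hT t ht hPN
      have hbi := abs_le.1 (hb i hi)
      have h1 : a (t - b) ≤ M ^ (2 * b) * a (t - i) := by
        have h2 := le_pow_mul_shift hM haM (t - b) (b - i).toNat
        have h3 : t - b + ((b - i).toNat : ℤ) = t - i := by omega
        rw [h3] at h2
        refine h2.trans (mul_le_mul_of_nonneg_right (pow_le_pow_right₀ hM ?_) (ha _))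
        omega
      calc a (t - b) * (c * N) ≤ (M ^ (2 * b) * a (t - i)) * diffCount S (t - i) :=
            mul_le_mul h1 hti (by positivity) (mul_nonneg (by positivity) (ha _))
        _ = M ^ (2 * b) * (a (t - i) * diffCount S (t - i)) := by ring
        _ ≤ _ := Finset.single_le_sum
            (f := fun i => M ^ (2 * b) * (a (t - i) * (diffCount S (t - i) : ℝ)))
            (fun i _ => mul_nonneg (by positivity) (mul_nonneg (ha _) (by positivity))) hi
    have hsum : (∑ t ∈ T, a (t - b)) * (c * N) ≤ M ^ (2 * b) * (F.card * (C * 2)) * N := by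
      rw [Finset.sum_mul]
      calc ∑ t ∈ T, a (t - b) * (c * N)
          ≤ ∑ t ∈ T, ∑ i ∈ F, M ^ (2 * b) * (a (t - i) * diffCount S (t - i)) :=
            Finset.sum_le_sum hpt
        _ = ∑ i ∈ F, M ^ (2 * b) * ∑ t ∈ T, a (t - i) * diffCount S (t - i) := by
            rw [Finset.sum_comm]
            simp_rw [Finset.mul_sum]
        _ ≤ ∑ i ∈ F, M ^ (2 * b) * (C * (2 * N)) := by
            refine Finset.sum_le_sum fun i _ => ?_
            gcongr
            have h := sum_mul_diffCount_le ha hSC (T.map (addRightEmbedding (-i)))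
            rw [Finset.sum_map] at h
            simp only [addRightEmbedding_apply, ← sub_eq_add_neg] at h
            exact h.trans (by gcongr)
        _ = _ := by rw [Finset.sum_const, nsmul_eq_mul]; ring
    rw [le_div_iff₀ hc0]
    have hN0 : (0 : ℝ) < N := by linarith
    refine le_of_mul_le_mul_right ?_ hN0
    rw [mul_assoc]
    exact hsum
  exact (Equiv.subRight (b : ℤ)).summable_iff.1 hshift

/-! ### The weighted shift as a translation -/

/-- The positive sequence `γ` with `γ 0 = 1` and `γ j = w (j + 1) * γ (j + 1)`: it equals
`1 / (w 1 ⋯ w j)` for `j ≥ 0` and `w (j + 1) ⋯ w 0` for `j ≤ 0`. Dividing the coordinates by `γ`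
turns the weighted shift into the unweighted one. -/
noncomputable def shiftScale (w : ℤ → ℝ) (j : ℤ) : ℝ :=
  (∏ k ∈ Finset.Icc 1 j, w k)⁻¹ * ∏ k ∈ Finset.Icc (j + 1) 0, w k

theorem shiftScale_zero (w : ℤ → ℝ) : shiftScale w 0 = 1 := by simp [shiftScale]

theorem shiftScale_pos {w : ℤ → ℝ} (hpos : ∀ n, 0 < w n) (j : ℤ) : 0 < shiftScale w j :=
  mul_pos (inv_pos.2 (Finset.prod_pos fun _ _ => hpos _)) (Finset.prod_pos fun _ _ => hpos _)

theorem shiftScale_of_nonneg (w : ℤ → ℝ) {j : ℤ} (hj : 0 ≤ j) :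
    shiftScale w j = (∏ k ∈ Finset.Icc 1 j, w k)⁻¹ := by
  rw [shiftScale, Finset.Icc_eq_empty (a := j + 1) (by omega), Finset.prod_empty, mul_one]

theorem shiftScale_of_nonpos (w : ℤ → ℝ) {j : ℤ} (hj : j ≤ 0) :
    shiftScale w j = ∏ k ∈ Finset.Icc (j + 1) 0, w k := by
  rw [shiftScale, Finset.Icc_eq_empty (b := j) (by omega), Finset.prod_empty, inv_one, one_mul]

theorem shiftScale_eq_mul {w : ℤ → ℝ} (hpos : ∀ n, 0 < w n) (j : ℤ) :
    shiftScale w j = w (j + 1) * shiftScale w (j + 1) := by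
  have hw := (hpos (j + 1)).ne'
  rcases le_or_gt 0 j with hj | hj
  · have h : Finset.Icc 1 (j + 1) = insert (j + 1) (Finset.Icc 1 j) := by ext; simp; omega
    rw [shiftScale_of_nonneg w hj, shiftScale_of_nonneg w (by omega), h,
      Finset.prod_insert (by simp), mul_inv, mul_inv_cancel_left₀ hw]
  · have h : Finset.Icc (j + 1) 0 = insert (j + 1) (Finset.Icc (j + 1 + 1) 0) := by
      ext; simp; omega
    rw [shiftScale_of_nonpos w hj.le, shiftScale_of_nonpos w (j := j + 1) (by omega), h,
      Finset.prod_insert (by simp)]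

/-- The two series of the characterization are the two halves of the series of `γ ^ q`, up to the
factor `w 0 ^ q` and a shift of the index in the second one. -/
theorem summable_shiftScale_rpow_iff {w : ℤ → ℝ} (hpos : ∀ n, 0 < w n) (q : ℝ) :
    (Summable (fun n : {n : ℤ // 1 ≤ n} => 1 / (∏ k ∈ Finset.Icc 1 (n : ℤ), w k) ^ q) ∧
      Summable (fun n : {n : ℤ // n < 0} => (∏ k ∈ Finset.Icc (n : ℤ) (-1), w k) ^ q)) ↔
    Summable fun j : ℤ => shiftScale w j ^ q := by
  have hprod : ∀ s : Finset ℤ, 0 ≤ ∏ k ∈ s, w k := fun s =>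
    Finset.prod_nonneg fun _ _ => (hpos _).le
  have h1 : (fun n : {n : ℤ // 1 ≤ n} => 1 / (∏ k ∈ Finset.Icc 1 (n : ℤ), w k) ^ q) =
      fun n : {n : ℤ // 1 ≤ n} => shiftScale w n ^ q := by
    ext ⟨n, hn⟩
    simp only
    rw [shiftScale_of_nonneg w (by omega), Real.inv_rpow (hprod _), one_div]
  have h2 : (fun n : {n : ℤ // n < 0} => shiftScale w (n - 1) ^ q) =
      fun n : {n : ℤ // n < 0} => w 0 ^ q * (∏ k ∈ Finset.Icc (n : ℤ) (-1), w k) ^ q := by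
    ext ⟨n, hn⟩
    have h : Finset.Icc (n - 1 + 1) 0 = insert 0 (Finset.Icc n (-1)) := by ext; simp; omega
    simp only
    rw [shiftScale_of_nonpos w (by omega), h, Finset.prod_insert (by simp),
      Real.mul_rpow (hpos 0).le (hprod _)]
  rw [h1, ← summable_mul_left_iff (Real.rpow_pos_of_pos (hpos 0) q).ne'
    (f := fun n : {n : ℤ // n < 0} => (∏ k ∈ Finset.Icc (n : ℤ) (-1), w k) ^ q), ← h2]
  constructor
  · rintro ⟨ha, hb⟩
    set f : ℤ → ℝ := fun j => shiftScale w j ^ q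
    have ha' : Summable (Set.indicator {n : ℤ | 1 ≤ n} f) := summable_subtype_iff_indicator.1 ha
    have hb' : Summable (Set.indicator {n : ℤ | n < 0} fun n => f (n - 1)) :=
      summable_subtype_iff_indicator.1 hb
    have hc : Summable (Set.indicator ({-1, 0} : Set ℤ) f) :=
      summable_of_hasFiniteSupport ((Set.toFinite ({-1, 0} : Set ℤ)).subset
        Set.support_indicator_subset)
    refine ((ha'.add ((Equiv.addRight (1 : ℤ)).summable_iff.2 hb')).add hc).congr fun j => ?_
    simp only [Function.comp_apply, Equiv.coe_addRight, Set.indicator_apply, Set.mem_ofPred_eq,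
      add_sub_cancel_right, Set.mem_insert_iff, Set.mem_singleton_iff]
    split_ifs <;> first | omega | simp
  · intro h
    exact ⟨h.comp_injective Subtype.val_injective,
      h.comp_injective (i := fun n : {n : ℤ // n < 0} => (n : ℤ) - 1)
        (sub_left_injective.comp Subtype.val_injective)⟩

section

variable {𝕜 : Type*} [RCLike 𝕜] {p : ℝ≥0∞} [Fact (1 ≤ p)] {w : ℤ → ℝ}

theorem bilateralShift_pow_apply_mul (hpos : ∀ n, 0 < w n) (hbdd : BddAbove (Set.range w))
    (x : lp (fun _ : ℤ => 𝕜) p) (n : ℕ) (j : ℤ) :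
    (bilateralShift 𝕜 w hpos hbdd ^ n) x j * (shiftScale w (j + n) : 𝕜) =
      (shiftScale w j : 𝕜) * x (j + n) := by
  induction n generalizing x with
  | zero => simp [mul_comm]
  | succ n ih =>
    have h := ih (bilateralShift 𝕜 w hpos hbdd x)
    rw [bilateralShift_apply, shiftScale_eq_mul hpos (j + n)] at h
    have hw : (w (j + n + 1) : 𝕜) ≠ 0 := by exact_mod_cast (hpos _).ne'
    have hB : (bilateralShift 𝕜 w hpos hbdd ^ (n + 1)) x =
        (bilateralShift 𝕜 w hpos hbdd ^ n) (bilateralShift 𝕜 w hpos hbdd x) := by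
      rw [pow_succ]
      rfl
    rw [hB, Nat.cast_succ, ← add_assoc]
    refine mul_left_cancel₀ hw ?_
    rw [RCLike.ofReal_mul] at h
    linear_combination h

theorem norm_bilateralShift_pow_apply_mul (hpos : ∀ n, 0 < w n) (hbdd : BddAbove (Set.range w))
    (x : lp (fun _ : ℤ => 𝕜) p) (n : ℕ) (j : ℤ) :
    ‖(bilateralShift 𝕜 w hpos hbdd ^ n) x j‖ * shiftScale w (j + n) =
      shiftScale w j * ‖x (j + n)‖ := by
  have h := congrArg norm (bilateralShift_pow_apply_mul hpos hbdd x n j)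
  rwa [norm_mul, norm_mul, RCLike.norm_ofReal, RCLike.norm_ofReal,
    abs_of_pos (shiftScale_pos hpos _), abs_of_pos (shiftScale_pos hpos _)] at h

/-- If `A` is the set of times at which the orbit of `x` is close to `e₀`, then for `n, m ∈ A` the
coordinate `m - n` of `B ^ n x` is at least `γ (m - n) / 2`. -/
theorem summable_shiftScale_of_isUFrequentlyHypercyclic (hp : p ≠ ∞) (hpos : ∀ n, 0 < w n)
    (hbdd : BddAbove (Set.range w))
    (h : IsUFrequentlyHypercyclic (bilateralShift 𝕜 w hpos hbdd :
        lp (fun _ : ℤ => 𝕜) p →L[𝕜] lp (fun _ : ℤ => 𝕜) p)) :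
    Summable fun j : ℤ => shiftScale w j ^ p.toReal := by
  have hp0 : 0 < p.toReal :=
    ENNReal.toReal_pos (zero_lt_one.trans_le (Fact.out : 1 ≤ p)).ne' hp
  obtain ⟨x, hx⟩ := h
  set B : lp (fun _ : ℤ => 𝕜) p →L[𝕜] lp (fun _ : ℤ => 𝕜) p := bilateralShift 𝕜 w hpos hbdd
  set e : lp (fun _ : ℤ => 𝕜) p := lp.single p 0 1
  have hγ : ∀ j, 0 < shiftScale w j := shiftScale_pos hpos
  have he : ‖e‖ = 1 := by
    rw [lp.norm_single (zero_lt_one.trans_le (Fact.out : 1 ≤ p)), norm_one]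
  have hA := hx (Metric.ball e (1 / 2)) Metric.isOpen_ball ⟨e, Metric.mem_ball_self (by norm_num)⟩
  set A := {n : ℕ | (B ^ n) x ∈ Metric.ball e (1 / 2)}
  have hxA : ∀ m ∈ A, shiftScale w m / 2 ≤ ‖x m‖ := by
    intro m hm
    have h1 : ‖(B ^ m) x 0 - 1‖ ≤ 1 / 2 := by
      have h2 := lp.norm_apply_le_norm (zero_lt_one.trans_le (Fact.out : 1 ≤ p)).ne'
        ((B ^ m) x - e) 0
      have h3 : ((B ^ m) x - e) 0 = (B ^ m) x 0 - 1 := by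
        rw [lp.coeFn_sub, Pi.sub_apply, lp.single_apply_self]
      rw [h3] at h2
      exact h2.trans (mem_ball_iff_norm.1 hm).le
    have h2 : 1 / 2 ≤ ‖(B ^ m) x 0‖ := by
      have := norm_sub_norm_le (1 : 𝕜) ((B ^ m) x 0)
      rw [norm_one, norm_sub_rev] at this
      linarith
    have h3 := norm_bilateralShift_pow_apply_mul hpos hbdd x m 0
    rw [zero_add, shiftScale_zero, one_mul] at h3
    rw [← h3]
    nlinarith [hγ m]
  obtain ⟨C, hC⟩ := id hbdd
  refine summable_of_sum_translate_le hA (M := max 1 (C ^ p.toReal)) (C := 3 ^ p.toReal)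
    (fun j => (Real.rpow_pos_of_pos (hγ j) _).le) (le_max_left _ _) (fun j => ?_) fun n hn N => ?_
  · rw [shiftScale_eq_mul hpos j, Real.mul_rpow (hpos _).le (hγ _).le]
    refine mul_le_mul_of_nonneg_right ?_ (Real.rpow_nonneg (hγ _).le _)
    exact (Real.rpow_le_rpow (hpos _).le (hC ⟨_, rfl⟩) hp0.le).trans (le_max_right _ _)
  · have hnorm : ‖(B ^ n) x‖ ≤ 3 / 2 := by
      have h1 := norm_add_le ((B ^ n) x - e) e
      rw [sub_add_cancel, he] at h1
      have h2 := mem_ball_iff_norm.1 (show (B ^ n) x ∈ Metric.ball e (1 / 2) from hn)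
      linarith
    have hpt : ∀ m ∈ initialSegment A N,
        shiftScale w (m - n) ^ p.toReal ≤ 2 ^ p.toReal * ‖(B ^ n) x (m - n)‖ ^ p.toReal := by
      intro m hm
      obtain ⟨m, hmA, -, rfl⟩ := mem_initialSegment.1 hm
      rw [← Real.mul_rpow (by norm_num) (norm_nonneg _)]
      refine Real.rpow_le_rpow (hγ _).le ?_ hp0.le
      have h1 := norm_bilateralShift_pow_apply_mul hpos hbdd x n (m - n)
      rw [sub_add_cancel] at h1
      have h2 := mul_le_mul_of_nonneg_left (hxA m hmA) (hγ (m - n)).le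
      rw [← h1] at h2
      refine le_of_mul_le_mul_right ?_ (hγ m)
      linarith
    calc ∑ m ∈ initialSegment A N, shiftScale w (m - n) ^ p.toReal
        ≤ ∑ m ∈ initialSegment A N, 2 ^ p.toReal * ‖(B ^ n) x (m - n)‖ ^ p.toReal :=
          Finset.sum_le_sum hpt
      _ = 2 ^ p.toReal * ∑ j ∈ (initialSegment A N).map (addRightEmbedding (-(n : ℤ))),
            ‖(B ^ n) x j‖ ^ p.toReal := by
          rw [Finset.sum_map, ← Finset.mul_sum]
          simp only [addRightEmbedding_apply, ← sub_eq_add_neg]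
      _ ≤ 2 ^ p.toReal * (3 / 2) ^ p.toReal := by
          gcongr
          exact (lp.sum_rpow_le_norm_rpow hp0 _ _).trans
            (Real.rpow_le_rpow (norm_nonneg _) hnorm hp0.le)
      _ = 3 ^ p.toReal := by
          rw [← Real.mul_rpow (by norm_num) (by norm_num)]
          norm_num

end

/-! ### A slowly growing weight that preserves summability -/

theorem exists_nat_forall_sum_le {c : ℤ → ℝ} (hc : Summable c) {ε : ℝ} (hε : 0 < ε) :
    ∃ N : ℕ, ∀ T : Finset ℤ, (∀ j ∈ T, N < j.natAbs) → ∑ j ∈ T, c j ≤ ε := by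
  obtain ⟨s, hs⟩ := summable_iff_vanishing_norm.1 hc ε hε
  refine ⟨s.sup Int.natAbs, fun T hT => (le_abs_self _).trans (hs T ?_).le⟩
  refine Finset.disjoint_left.2 fun j hj hjs => ?_
  exact absurd (Finset.le_sup (f := Int.natAbs) hjs) (not_le.2 (hT j hj))

/-- A summable family stays summable after multiplication with a suitable weight that tends to
infinity: the weight increases by one whenever the remaining tail has been halved. -/
theorem exists_monotone_tendsto_summable_mul {c : ℤ → ℝ} (hc0 : ∀ j, 0 ≤ c j) (hc : Summable c) :
    ∃ h : ℕ → ℝ, Monotone h ∧ (∀ n, 0 ≤ h n) ∧ Tendsto h atTop atTop ∧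
      Summable fun j : ℤ => c j * h j.natAbs := by
  obtain ⟨φ, hφ, hφc⟩ := extraction_forall_of_eventually
    (P := fun m N => ∀ T : Finset ℤ, (∀ j ∈ T, N ≤ j.natAbs) → ∑ j ∈ T, c j ≤ (1 / 2 : ℝ) ^ m)
    fun m => by
      obtain ⟨N, hN⟩ := exists_nat_forall_sum_le hc (ε := (1 / 2 : ℝ) ^ m) (by positivity)
      filter_upwards [eventually_gt_atTop N] with N' hN' T hT
      exact hN T fun j hj => hN'.trans_le (hT j hj)
  let g : ℕ → Finset ℕ := fun N => (Finset.range (N + 1)).filter fun m => φ m ≤ N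
  have hg : ∀ N m, m ∈ g N ↔ φ m ≤ N := fun N m => by
    simp only [g, Finset.mem_filter, Finset.mem_range, and_iff_right_iff_imp]
    intro h
    have := hφ.le_apply (x := m)
    omega
  have hmono : Monotone fun N => ((g N).card : ℝ) := by
    intro N N' h
    refine Nat.cast_le.2 (Finset.card_le_card fun m hm => ?_)
    rw [hg] at hm ⊢
    exact hm.trans h
  refine ⟨fun N => (g N).card, hmono, fun n => by positivity, ?_, ?_⟩
  · refine tendsto_atTop_atTop_of_monotone hmono fun b => ?_
    obtain ⟨m, hm⟩ := exists_nat_ge b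
    refine ⟨φ m, hm.trans (Nat.cast_le.2 ?_)⟩
    calc m = (Finset.range m).card := (Finset.card_range m).symm
      _ ≤ (g (φ m)).card := Finset.card_le_card fun i hi => by
        rw [hg]
        exact hφ.monotone (Finset.mem_range.1 hi).le
  · refine summable_of_sum_le (c := 2)
      (fun j => mul_nonneg (hc0 j) (Nat.cast_nonneg _)) fun T => ?_
    set R := T.sup Int.natAbs + 1
    have hgR : ∀ j ∈ T, g j.natAbs = (Finset.range R).filter fun m => φ m ≤ j.natAbs := by
      intro j hj
      ext m
      have h1 := hφ.le_apply (x := m)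
      have h2 := Finset.le_sup (f := Int.natAbs) hj
      rw [hg, Finset.mem_filter, Finset.mem_range]
      constructor
      · intro h
        exact ⟨by omega, h⟩
      · exact fun h => h.2
    calc ∑ j ∈ T, c j * ((g j.natAbs).card : ℝ)
        = ∑ j ∈ T, ∑ m ∈ Finset.range R, if φ m ≤ j.natAbs then c j else 0 := by
          refine Finset.sum_congr rfl fun j hj => ?_
          rw [← Finset.sum_filter, Finset.sum_const, nsmul_eq_mul, mul_comm, hgR j hj]
      _ = ∑ m ∈ Finset.range R, ∑ j ∈ T.filter (fun j => φ m ≤ j.natAbs), c j := by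
          rw [Finset.sum_comm]
          simp_rw [Finset.sum_filter]
      _ ≤ ∑ m ∈ Finset.range R, (1 / 2 : ℝ) ^ m := Finset.sum_le_sum fun m _ =>
          hφc m _ fun j hj => (Finset.mem_filter.1 hj).2
      _ ≤ 2 := sum_geometric_two_le R

/-! ### Gluing blocks along a separated sequence of linear growth -/

/-- The positions of the blocks: the block of index `k` has radius at most `v₂ k`, and consecutive
blocks are placed as closely as these radii permit. The junk value `v₂ 0 = 0` is harmless: it gives
the block of index `0` the radius `0`. -/
noncomputable def blockPosition (k : ℕ) : ℕ :=
  ∑ i ∈ Finset.range k, (padicValNat 2 i + padicValNat 2 (i + 1) + 1)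

theorem blockPosition_add_lt {k l : ℕ} (h : k < l) :
    blockPosition k + padicValNat 2 k + padicValNat 2 l < blockPosition l := by
  induction l, h using Nat.le_induction with
  | base => simp only [blockPosition, Finset.sum_range_succ, Nat.succ_eq_add_one]; omega
  | succ l _ ih =>
    simp only [blockPosition, Finset.sum_range_succ] at ih ⊢
    omega

theorem blockPosition_strictMono : StrictMono blockPosition := fun _ _ h =>
  (Nat.le_add_right _ _).trans_lt ((Nat.le_add_right _ _).trans_lt (blockPosition_add_lt h))

theorem sum_padicValNat_two_le (k : ℕ) :
    ∑ i ∈ Finset.range k, padicValNat 2 (i + 1) ≤ k := by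
  have h : ∑ i ∈ Finset.range k, padicValNat 2 (i + 1) = padicValNat 2 k.factorial := by
    induction k with
    | zero => simp
    | succ k ih =>
      rw [Finset.sum_range_succ, ih, Nat.factorial_succ,
        padicValNat.mul (Nat.succ_ne_zero k) (Nat.factorial_ne_zero k), add_comm]
  rw [h]
  have := sub_one_mul_padicValNat_factorial (p := 2) k
  omega

theorem blockPosition_le (k : ℕ) : blockPosition k ≤ 3 * k := by
  have h1 := sum_padicValNat_two_le k
  have h2 : ∑ i ∈ Finset.range k, padicValNat 2 i ≤
      ∑ i ∈ Finset.range k, padicValNat 2 (i + 1) := by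
    have h3 := Finset.sum_range_succ (fun i => padicValNat 2 i) k
    rw [Finset.sum_range_succ', padicValNat_zero_right] at h3
    omega
  rw [blockPosition, Finset.sum_add_distrib, Finset.sum_add_distrib]
  simp only [Finset.sum_const, Finset.card_range, smul_eq_mul, mul_one]
  omega

/-- The positions of the blocks of a given level `a` have positive lower density. -/
theorem lowerDensity_blockPosition_pos {A : Set ℕ} {a : ℕ}
    (hA : ∀ k, padicValNat 2 k = a → blockPosition k ∈ A) : 0 < lowerDensity A := by
  refine lowerDensity_pos_of_linear_growth (f := fun t => blockPosition (2 ^ a * (2 * t + 1)))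
    (C := 6 * 2 ^ a) (fun s t hst => ?_) (by positivity) (fun t => ?_) fun t => hA _ ?_
  · have h := Nat.eq_of_mul_eq_mul_left (by positivity) (blockPosition_strictMono.injective hst)
    omega
  · refine (blockPosition_le _).trans ?_
    have : 0 < 2 ^ a := by positivity
    nlinarith
  · rw [padicValNat.mul (by positivity) (by omega), padicValNat.prime_pow,
      padicValNat.eq_zero_of_not_dvd (by omega), add_zero]

/-- A sequence of blocks `z k` centred at the positions can be glued. Seen from the centre of the
block of index `k`, the glued sequence differs from `z k` only outside the radius `v₂ k`, and there
it is bounded by `h`: a point of another block is at least as far from the centre of the block `k`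
as it is from the boundary of its own block. -/
theorem exists_glue {𝕜 : Type*} [NormedField 𝕜] {h : ℕ → ℝ} (hmono : Monotone h)
    (h0 : ∀ n, 0 ≤ h n) {q : ℝ} (hq : 0 < q) {z : ℕ → ℤ → 𝕜}
    (hz : ∀ k i, z k i ≠ 0 → i.natAbs ≤ padicValNat 2 k ∧
      ‖z k i‖ ^ q ≤ h (padicValNat 2 k - i.natAbs)) :
    ∃ y : ℤ → 𝕜, ∀ k (j : ℤ), ‖y (j + blockPosition k) - z k j‖ ^ q ≤
      if padicValNat 2 k < j.natAbs then h j.natAbs else 0 := by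
  classical
  let P : ℤ → ℕ → Prop := fun j k => (j - blockPosition k).natAbs ≤ padicValNat 2 k
  have huniq : ∀ j k l, P j k → P j l → k = l := by
    intro j k l hk hl
    simp only [P] at hk hl
    rcases lt_trichotomy k l with hkl | hkl | hkl
    · have := blockPosition_add_lt hkl
      omega
    · exact hkl
    · have := blockPosition_add_lt hkl
      omega
  let y : ℤ → 𝕜 := fun j =>
    if hj : ∃ k, P j k then z hj.choose (j - blockPosition hj.choose) else 0
  have hy : ∀ j k, P j k → y j = z k (j - blockPosition k) := by
    intro j k hk
    have hj : ∃ k, P j k := ⟨k, hk⟩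
    simp only [y, dif_pos hj]
    rw [huniq j _ k hj.choose_spec hk]
  refine ⟨y, fun k j => ?_⟩
  by_cases hk : P (j + blockPosition k) k
  · rw [hy _ k hk, add_sub_cancel_right, sub_self, norm_zero, Real.zero_rpow hq.ne']
    split_ifs <;> simp [h0]
  · have hj : padicValNat 2 k < j.natAbs := by
      simpa [P] using hk
    have hzk : z k j = 0 := by
      by_contra hne
      exact absurd (hz k j hne).1 (not_le.2 hj)
    rw [if_pos hj, hzk, sub_zero]
    have hzero : ‖(0 : 𝕜)‖ ^ q ≤ h j.natAbs := by
      rw [norm_zero, Real.zero_rpow hq.ne']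
      exact h0 _
    by_cases hex : ∃ l, P (j + blockPosition k) l
    · obtain ⟨l, hl⟩ := hex
      rw [hy _ l hl]
      by_cases hne : z l (j + blockPosition k - blockPosition l) = 0
      · rwa [hne]
      · obtain ⟨h1, h2⟩ := hz l _ hne
        refine h2.trans (hmono ?_)
        rcases lt_trichotomy k l with hkl | rfl | hkl
        · have := blockPosition_add_lt hkl
          omega
        · exact absurd hl hk
        · have := blockPosition_add_lt hkl
          omega
    · simp only [y, dif_neg hex]
      exact hzero

/-! ### Construction of a frequently hypercyclic vector -/

section

variable {𝕜 : Type*} [RCLike 𝕜] {p : ℝ≥0∞} [Fact (1 ≤ p)] {w : ℤ → ℝ}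

theorem exists_denseRange_finite_support (hp : p ≠ ∞) :
    ∃ d : ℕ → lp (fun _ : ℤ => 𝕜) p, DenseRange d ∧ ∀ l, {i : ℤ | d l i ≠ 0}.Finite := by
  set V : Submodule 𝕜 (lp (fun _ : ℤ => 𝕜) p) :=
    Submodule.span 𝕜 (Set.range fun i : ℤ => lp.single p i (1 : 𝕜))
  have hV : Dense (V : Set (lp (fun _ : ℤ => 𝕜) p)) := by
    intro x
    refine mem_closure_of_tendsto (lp.hasSum_single hp x) (.of_forall fun s => ?_)
    refine V.sum_mem fun i _ => ?_
    have h1 : lp.single p i (x i) = x i • (lp.single p i (1 : 𝕜) : lp (fun _ : ℤ => 𝕜) p) := by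
      rw [← lp.single_smul, smul_eq_mul, mul_one]
    rw [h1]
    exact V.smul_mem _ (Submodule.subset_span ⟨i, rfl⟩)
  have hfin : ∀ x ∈ V, {i : ℤ | x i ≠ 0}.Finite := by
    intro x hx
    induction hx using Submodule.span_induction with
    | mem x hx =>
      obtain ⟨i, rfl⟩ := hx
      refine (Set.finite_singleton i).subset fun j hj => ?_
      by_contra hne
      exact hj (lp.single_apply_ne _ _ _ hne)
    | zero => simp
    | add x y _ _ hx hy =>
      refine (hx.union hy).subset fun j hj => ?_
      by_contra hne
      simp only [Set.mem_union, Set.mem_ofPred_eq, not_or, not_not] at hne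
      exact hj (by rw [lp.coeFn_add, Pi.add_apply, hne.1, hne.2, add_zero])
    | smul c x _ hx =>
      refine hx.subset fun j hj hne => hj ?_
      rw [lp.coeFn_smul, Pi.smul_apply, hne, smul_zero]
  have hsep : TopologicalSpace.IsSeparable (V : Set (lp (fun _ : ℤ => 𝕜) p)) :=
    (Set.countable_range _).isSeparable.span
  obtain ⟨c, hcV, hc, hVc⟩ := hsep.exists_countable_dense_subset
  have hcd : Dense c := by
    rw [← dense_closure]
    exact hV.mono hVc
  obtain ⟨d, rfl⟩ := hc.exists_eq_range hcd.nonempty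
  exact ⟨d, hcd, fun l => hfin _ (hcV ⟨l, rfl⟩)⟩

/-- If `γ ^ p` is summable, then gluing the vectors of a dense sequence, each of them along a set of
positions of positive lower density, produces a frequently hypercyclic vector. -/
theorem isFrequentlyHypercyclic_of_summable_shiftScale (hp : p ≠ ∞) (hpos : ∀ n, 0 < w n)
    (hbdd : BddAbove (Set.range w)) (hsum : Summable fun j : ℤ => shiftScale w j ^ p.toReal) :
    IsFrequentlyHypercyclic (bilateralShift 𝕜 w hpos hbdd :
        lp (fun _ : ℤ => 𝕜) p →L[𝕜] lp (fun _ : ℤ => 𝕜) p) := by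
  have hq : 0 < p.toReal :=
    ENNReal.toReal_pos (zero_lt_one.trans_le (Fact.out : 1 ≤ p)).ne' hp
  set q := p.toReal
  have hγ : ∀ j, 0 < shiftScale w j := shiftScale_pos hpos
  have hγ' : ∀ j, (shiftScale w j : 𝕜) ≠ 0 := fun j => by exact_mod_cast (hγ j).ne'
  obtain ⟨h, hmono, h0, htop, hh⟩ := exists_monotone_tendsto_summable_mul
    (fun j => Real.rpow_nonneg (hγ j).le q) hsum
  obtain ⟨d, hd, hdfin⟩ := exists_denseRange_finite_support (𝕜 := 𝕜) hp
  -- Each vector of the dense sequence is to occur at infinitely many levels.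
  set u : ℕ → lp (fun _ : ℤ => 𝕜) p := fun l => d l.unpair.1
  obtain ⟨a, ha, hau⟩ := extraction_forall_of_eventually
    (P := fun l N => 1 ≤ N ∧ ∀ i : ℤ, u l i ≠ 0 →
      i.natAbs ≤ N ∧ ‖u l i / (shiftScale w i : 𝕜)‖ ^ q ≤ h (N - i.natAbs)) fun l => by
    refine (eventually_ge_atTop 1).and ?_
    refine ((hdfin l.unpair.1).eventually_all (p := fun i N => i.natAbs ≤ N ∧
      ‖u l i / (shiftScale w i : 𝕜)‖ ^ q ≤ h (N - i.natAbs))).2 fun i _ => ?_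
    exact (eventually_ge_atTop _).and
      ((htop.comp (tendsto_sub_atTop_nat i.natAbs)).eventually_ge_atTop _)
  set Z : ℕ → ℤ → 𝕜 := Function.extend a (fun l i => u l i / (shiftScale w i : 𝕜)) 0
  have hZa : ∀ l i, Z (a l) i = u l i / (shiftScale w i : 𝕜) := fun l i => by
    simp only [Z]
    rw [ha.injective.extend_apply]
  have hZ : ∀ N i, Z N i ≠ 0 → i.natAbs ≤ N ∧ ‖Z N i‖ ^ q ≤ h (N - i.natAbs) := by
    intro N i hne
    by_cases hN : ∃ l, a l = N
    · obtain ⟨l, rfl⟩ := hN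
      rw [hZa] at hne ⊢
      exact (hau l).2 i fun h => hne (by rw [h, zero_div])
    · exact absurd (by simp only [Z, Function.extend_apply' _ _ _ hN, Pi.zero_apply]) hne
  have hZ0 : ∀ i, Z 0 i = 0 := by
    intro i
    have hN : ¬ ∃ l, a l = 0 := by
      rintro ⟨l, hl⟩
      have := (hau l).1
      omega
    simp only [Z, Function.extend_apply' _ _ _ hN, Pi.zero_apply]
  obtain ⟨y, hy⟩ := exists_glue hmono h0 hq (z := fun k => Z (padicValNat 2 k)) fun k => hZ _
  have hmem : Memℓp (fun j : ℤ => (shiftScale w j : 𝕜) * y j) p := by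
    refine memℓp_gen (Summable.of_nonneg_of_le (fun j => Real.rpow_nonneg (norm_nonneg _) _)
      (fun j => ?_) hh)
    have h1 := hy 0 j
    simp only [blockPosition, Finset.range_zero, Finset.sum_empty, Nat.cast_zero, add_zero,
      padicValNat_zero_right, hZ0, sub_zero] at h1
    rw [norm_mul, RCLike.norm_ofReal, abs_of_pos (hγ j),
      Real.mul_rpow (hγ j).le (norm_nonneg _)]
    refine mul_le_mul_of_nonneg_left (h1.trans ?_) (Real.rpow_nonneg (hγ j).le _)
    split_ifs <;> simp [h0]
  set x : lp (fun _ : ℤ => 𝕜) p := ⟨_, hmem⟩ with hx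
  set B : lp (fun _ : ℤ => 𝕜) p →L[𝕜] lp (fun _ : ℤ => 𝕜) p := bilateralShift 𝕜 w hpos hbdd
  have hBx : ∀ (n : ℕ) j, (B ^ n) x j = (shiftScale w j : 𝕜) * y (j + n) := by
    intro n j
    have h1 := bilateralShift_pow_apply_mul hpos hbdd x n j
    have h2 : x (j + n) = (shiftScale w (j + n) : 𝕜) * y (j + n) := rfl
    rw [h2] at h1
    refine mul_right_cancel₀ (hγ' (j + n)) (h1.trans (by ring))
  refine ⟨x, fun U hU hUne => ?_⟩
  obtain ⟨v, hv⟩ := hUne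
  obtain ⟨r, hr, hrU⟩ := Metric.isOpen_iff.1 hU v hv
  obtain ⟨i, hi⟩ := hd.exists_dist_lt v (half_pos hr)
  obtain ⟨N, hN⟩ := exists_nat_forall_sum_le hh (ε := (r / 2) ^ q) (by positivity)
  set l := Nat.pair i N with hl
  have hul : u l = d i := by simp only [u, hl, Nat.unpair_pair]
  have hNa : N ≤ a l := (Nat.right_le_pair i N).trans ha.le_apply
  refine lowerDensity_blockPosition_pos (a := a l) fun k hk => hrU ?_
  have hdist : ‖(B ^ blockPosition k) x - u l‖ ≤ r / 2 := by
    refine lp.norm_le_of_forall_sum_le hq (by positivity) fun s => ?_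
    have hpt : ∀ j ∈ s, ‖((B ^ blockPosition k) x - u l) j‖ ^ q ≤
        if N < j.natAbs then shiftScale w j ^ q * h j.natAbs else 0 := by
      intro j _
      have h1 : ((B ^ blockPosition k) x - u l) j =
          (shiftScale w j : 𝕜) * (y (j + blockPosition k) - Z (padicValNat 2 k) j) := by
        rw [lp.coeFn_sub, Pi.sub_apply, hBx, hk, hZa, mul_sub, mul_div_cancel₀ _ (hγ' j)]
      rw [h1, norm_mul, RCLike.norm_ofReal, abs_of_pos (hγ j),
        Real.mul_rpow (hγ j).le (norm_nonneg _)]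
      refine (mul_le_mul_of_nonneg_left (hy k j) (Real.rpow_nonneg (hγ j).le _)).trans ?_
      rw [hk]
      by_cases hj : a l < j.natAbs
      · rw [if_pos hj, if_pos (hNa.trans_lt hj)]
      · rw [if_neg hj, mul_zero]
        split_ifs
        · exact mul_nonneg (Real.rpow_nonneg (hγ j).le _) (h0 _)
        · exact le_rfl
    refine (Finset.sum_le_sum hpt).trans ?_
    rw [← Finset.sum_filter]
    exact hN _ fun j hj => (Finset.mem_filter.1 hj).2
  rw [mem_ball_iff_norm]
  have h2 : ‖d i - v‖ < r / 2 := by rwa [← dist_eq_norm, dist_comm]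
  calc ‖(B ^ blockPosition k) x - v‖ ≤ ‖(B ^ blockPosition k) x - u l‖ + ‖u l - v‖ :=
        norm_sub_le_norm_sub_add_norm_sub _ _ _
    _ < r := by rw [hul] at hdist ⊢; linarith

end

theorem theorem1 {𝕜 : Type*} [RCLike 𝕜] (p : ℝ≥0∞) [Fact (1 ≤ p)] (hp : p ≠ ∞)
    (w : ℤ → ℝ) (hpos : ∀ n, 0 < w n) (hbdd : BddAbove (Set.range w)) :
    List.TFAE [
      IsFrequentlyHypercyclic (bilateralShift 𝕜 w hpos hbdd :
        lp (fun _ : ℤ => 𝕜) p →L[𝕜] lp (fun _ : ℤ => 𝕜) p),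
      IsUFrequentlyHypercyclic (bilateralShift 𝕜 w hpos hbdd :
        lp (fun _ : ℤ => 𝕜) p →L[𝕜] lp (fun _ : ℤ => 𝕜) p),
      Summable (fun n : {n : ℤ // 1 ≤ n} =>
          1 / (∏ k ∈ Finset.Icc 1 (n : ℤ), w k) ^ p.toReal) ∧
        Summable (fun n : {n : ℤ // n < 0} =>
          (∏ k ∈ Finset.Icc (n : ℤ) (-1), w k) ^ p.toReal)] := by
  rw [summable_shiftScale_rpow_iff hpos]
  tfae_have 1 → 2 := fun ⟨x, hx⟩ =>
    ⟨x, fun U hU hUne => (hx U hU hUne).trans_le (lowerDensity_le_upperDensity _)⟩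
  tfae_have 2 → 3 := summable_shiftScale_of_isUFrequentlyHypercyclic hp hpos hbdd
  tfae_have 3 → 1 := isFrequentlyHypercyclic_of_summable_shiftScale hp hpos hbdd
  tfae_finish
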